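/- Let $V$ be a vertex operator algebra over $\mathbb{C}$ of CFT type (that is, $V_n=0$ for $n<0$ and $V_0=\mathbb{C}\mathbf{1}$), with vacuum vector $\mathbf{1}$ and $n$-th products $a_{(n)}b$ $(n\in\mathbb{Z})$, and let $d\ge 1$ be an integer. Let $T^d(V)=V^{\otimes d}$ be the tensor product vertex operator algebra, whose vacuum vector is $\mathbf{1}^{\otimes d}$ and whose products are $$(a^1\otimes\cdots\otimes a^d)_{(n)}(b^1\otimes\cdots\otimes b^d)=\sum_{(k_1+1)+\cdots+(k_d+1)=n+1} a^1_{(k_1)}b^1\otimes\cdots\otimes a^d_{(k_d)}b^d ,$$ let the symmetric group $S_d$ act on it by $\sigma(a^1\otimes\cdots\otimes a^d)=a^{\sigma^{-1}(1)}\otimes\cdots\otimes a^{\sigma^{-1}(d)}$, and let $T^d(V)^{S_d}$ be the fixed-point vertex operator subalgebra. Define the linear map $\eta:V\to T^d(V)^{S_d}$ by $$\eta(a)=a\otimes\mathbf{1}\otimes\cdots\otimes\mathbf{1}+\mathbf{1}\otimes a\otimes\mathbf{1}\otimes\cdots\otimes\mathbf{1}+\cdots+\mathbf{1}\otimes\cdots\otimes\mathbf{1}\otimes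 a .$$ Then $T^d(V)^{S_d}$ is strongly generated by the image of $\eta$; that is, it is spanned over $\mathbb{C}$ by the vectors $$\eta(a^1)_{(-n_1)}\eta(a^2)_{(-n_2)}\cdots\eta(a^r)_{(-n_r)}\mathbf{1}^{\otimes d}\qquad (r\ge 1,\ a^i\in V,\ n_i\ge 1).$$ -/

import Mathlib

open scoped TensorProduct

noncomputable section

/-- The data carried by a vertex operator algebra: a bilinear `n`-th product `a_(n) b` for every
integer `n`, with `a_(n) b = 0` for large `n`, a vacuum vector and a Virasoro vector.
`A.nprod n a b` is `a_(n) b`. -/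
structure VertexData (V : Type*) [AddCommGroup V] [Module ℂ V] where
  nprod : ℤ → V →ₗ[ℂ] V →ₗ[ℂ] V
  vac : V
  conf : V
  truncation : ∀ a b : V, ∃ N : ℤ, ∀ n : ℤ, N ≤ n → nprod n a b = 0

namespace VertexData

section Basic

variable {V : Type*} [AddCommGroup V] [Module ℂ V] (A : VertexData V)

/-- The operator `L_n = ω_(n+1)`. -/
def vir (n : ℤ) : V →ₗ[ℂ] V := A.nprod (n + 1) A.conf

/-- The weight space `V_n`: the eigenspace of `L_0` for the eigenvalue `n`. -/
def weightSpace (n : ℤ) : Submodule ℂ V := Module.End.eigenspace (A.vir 0) (n : ℂ)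

/-- The axioms of a vertex operator algebra over `ℂ`. All the sums in the Borcherds identity
have finite support by `truncation`. -/
structure IsVOA : Prop where
  vac_nprod : ∀ (n : ℤ) (a : V), A.nprod n A.vac a = if n = -1 then a else 0
  nprod_vac : ∀ a : V, A.nprod (-1) a A.vac = a
  nprod_vac_of_nonneg : ∀ (n : ℤ) (a : V), 0 ≤ n → A.nprod n a A.vac = 0
  borcherds : ∀ (a b c : V) (p q r : ℤ),
    ∑ᶠ i : ℕ, (Ring.choose p i : ℤ) • A.nprod (p + q - i) (A.nprod (r + i) a b) c =
      ∑ᶠ i : ℕ, ((-1 : ℤ) ^ i * Ring.choose r i) •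
        (A.nprod (p + r - i) a (A.nprod (q + i) b c)
          - (-1 : ℂ) ^ r • A.nprod (q + r - i) b (A.nprod (p + i) a c))
  virasoro : ∃ c : ℂ, ∀ (m n : ℤ) (v : V),
    A.vir m (A.vir n v) - A.vir n (A.vir m v) =
      ((m : ℂ) - n) • A.vir (m + n) v
        + (if m + n = 0 then ((m : ℂ) ^ 3 - m) / 12 * c else 0) • v
  translation : ∀ (n : ℤ) (a b : V),
    A.nprod n (A.vir (-1) a) b = (-n : ℂ) • A.nprod (n - 1) a b
  vac_mem : A.vac ∈ A.weightSpace 0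
  conf_mem : A.conf ∈ A.weightSpace 2
  grading : DirectSum.IsInternal A.weightSpace
  finiteDimensional : ∀ n : ℤ, FiniteDimensional ℂ (A.weightSpace n)
  bounded_below : ∃ t : ℕ, ∀ n : ℤ, n < -(t : ℤ) → A.weightSpace n = ⊥

/-- CFT type: `V_n = 0` for `n < 0` and `V_0 = ℂ 1`. -/
def IsCFTType : Prop :=
  (∀ n : ℤ, n < 0 → A.weightSpace n = ⊥) ∧ A.weightSpace 0 = Submodule.span ℂ {A.vac}

/-- The span of all `a¹_(-n₁) ⋯ aʳ_(-nᵣ) 1` with `r ≥ 1`, `aⁱ ∈ S` and `nᵢ ≥ 1`. A word is the list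
of the pairs `(aⁱ, nᵢ)`. -/
def strongSpan (S : Set V) : Submodule ℂ V :=
  Submodule.span ℂ {v | ∃ w : List (V × ℕ), w ≠ [] ∧ (∀ p ∈ w, p.1 ∈ S ∧ 1 ≤ p.2) ∧
    v = w.foldr (fun p u => A.nprod (-(p.2 : ℤ)) p.1 u) A.vac}

/-- The algebra is strongly generated by `S`. -/
def IsStronglyGeneratedBy (S : Set V) : Prop := A.strongSpan S = ⊤

end Basic

/-! ### The tensor power and its permutation orbifolds -/

section Tensor

variable {V : Type*} [AddCommGroup V] [Module ℂ V] (A : VertexData V) (d : ℕ)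

/-- For `k = (k₁, …, k_d)`, the bilinear map on the `d`-th tensor power with
`(a¹ ⊗ ⋯ ⊗ aᵈ, b¹ ⊗ ⋯ ⊗ bᵈ) ↦ a¹_(k₁) b¹ ⊗ ⋯ ⊗ aᵈ_(k_d) bᵈ`. -/
def tensorTerm (k : Fin d → ℤ) :
    (⨂[ℂ] _ : Fin d, V) →ₗ[ℂ] (⨂[ℂ] _ : Fin d, V) →ₗ[ℂ] (⨂[ℂ] _ : Fin d, V) :=
  PiTensorProduct.map₂ fun i => A.nprod (k i)

theorem tensorTerm_tprod (k : Fin d → ℤ) (a b : Fin d → V) :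
    A.tensorTerm d k (PiTensorProduct.tprod ℂ a) (PiTensorProduct.tprod ℂ b) =
      PiTensorProduct.tprod ℂ fun i => A.nprod (k i) (a i) (b i) :=
  PiTensorProduct.map₂_tprod_tprod _ _ _

theorem exists_tensorTerm_eq_zero (x y : ⨂[ℂ] _ : Fin d, V) :
    ∃ N : ℕ, ∀ k : Fin d → ℤ, (∃ i, (N : ℤ) ≤ k i) → A.tensorTerm d k x y = 0 := by
  induction x using PiTensorProduct.induction_on with
  | smul_tprod r a =>
    induction y using PiTensorProduct.induction_on with
    | smul_tprod s b =>
      choose N hN using fun i => A.truncation (a i) (b i)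
      refine ⟨∑ i, (N i).toNat, ?_⟩
      rintro k ⟨i, hi⟩
      have h1 : (N i).toNat ≤ ∑ i, (N i).toNat :=
        Finset.single_le_sum (f := fun i => (N i).toNat) (fun _ _ => Nat.zero_le _)
          (Finset.mem_univ i)
      have h2 : A.nprod (k i) (a i) (b i) = 0 := hN i _ (by omega)
      simp only [map_smul, LinearMap.smul_apply, tensorTerm_tprod]
      rw [(PiTensorProduct.tprod ℂ).map_coord_zero i h2]
      simp
    | add y₁ y₂ h₁ h₂ =>
      obtain ⟨N₁, h₁⟩ := h₁
      obtain ⟨N₂, h₂⟩ := h₂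
      refine ⟨max N₁ N₂, ?_⟩
      rintro k ⟨i, hi⟩
      rw [map_add, h₁ k ⟨i, by omega⟩, h₂ k ⟨i, by omega⟩, add_zero]
  | add x₁ x₂ h₁ h₂ =>
    obtain ⟨N₁, h₁⟩ := h₁
    obtain ⟨N₂, h₂⟩ := h₂
    refine ⟨max N₁ N₂, ?_⟩
    rintro k ⟨i, hi⟩
    rw [map_add, LinearMap.add_apply, h₁ k ⟨i, by omega⟩, h₂ k ⟨i, by omega⟩, add_zero]

/-- The `k = (k₁, …, k_d)` with `∏ z ^ (-kᵢ - 1) = z ^ (-n - 1)`. -/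
abbrev TensorIndex (d : ℕ) (n : ℤ) : Type := {k : Fin d → ℤ // ∑ i, (k i + 1) = n + 1}

theorem finite_support_tensorTerm (n : ℤ) (x y : ⨂[ℂ] _ : Fin d, V) :
    (Function.support fun k : TensorIndex d n => A.tensorTerm d k.1 x y).Finite := by
  obtain ⟨N, hN⟩ := A.exists_tensorTerm_eq_zero d x y
  refine Set.Finite.of_finite_image (f := Subtype.val) ?_ Subtype.val_injective.injOn
  refine (Set.finite_Icc (fun _ : Fin d => n - d * (N : ℤ)) (fun _ => (N : ℤ))).subset ?_
  rintro _ ⟨⟨k, hk⟩, hk', rfl⟩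
  have hlt : ∀ i, k i < N := by
    intro i
    by_contra h
    exact hk' (hN k ⟨i, by omega⟩)
  refine ⟨fun i => ?_, fun i => (hlt i).le⟩
  have h1 : ∑ j ∈ Finset.univ.erase i, (k j + 1) ≤ (Finset.univ.erase i).card • (N : ℤ) :=
    Finset.sum_le_card_nsmul _ _ _ fun j _ => hlt j
  have h2 := Finset.add_sum_erase Finset.univ (fun j => k j + 1) (Finset.mem_univ i)
  have h3 : (Finset.univ.erase i).card ≤ d := by simp
  have h4 : (((Finset.univ.erase i).card : ℕ) : ℤ) * N ≤ d * N := by gcongr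
  rw [nsmul_eq_mul] at h1
  change n - d * (N : ℤ) ≤ k i
  linarith

/-- The `n`-th product of the tensor power: `Y(a¹ ⊗ ⋯ ⊗ aᵈ, z) = Y(a¹, z) ⊗ ⋯ ⊗ Y(aᵈ, z)`, that is,
the sum of `a¹_(k₁) b¹ ⊗ ⋯ ⊗ aᵈ_(k_d) bᵈ` over all `k` with `∑ (kᵢ + 1) = n + 1`. -/
def tensorNprod (n : ℤ) :
    (⨂[ℂ] _ : Fin d, V) →ₗ[ℂ] (⨂[ℂ] _ : Fin d, V) →ₗ[ℂ] (⨂[ℂ] _ : Fin d, V) :=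
  LinearMap.mk₂ ℂ (fun x y => ∑ᶠ k : TensorIndex d n, A.tensorTerm d k.1 x y)
    (fun x₁ x₂ y => by
      simp only [map_add, LinearMap.add_apply]
      exact finsum_add_distrib (A.finite_support_tensorTerm d n x₁ y)
        (A.finite_support_tensorTerm d n x₂ y))
    (fun c x y => by
      simp only [map_smul, LinearMap.smul_apply]
      exact (smul_finsum' c (A.finite_support_tensorTerm d n x y)).symm)
    (fun x y₁ y₂ => by
      simp only [map_add]
      exact finsum_add_distrib (A.finite_support_tensorTerm d n x y₁)
        (A.finite_support_tensorTerm d n x y₂))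
    (fun c x y => by
      simp only [map_smul]
      exact (smul_finsum' c (A.finite_support_tensorTerm d n x y)).symm)

theorem tensorNprod_apply (n : ℤ) (x y : ⨂[ℂ] _ : Fin d, V) :
    A.tensorNprod d n x y = ∑ᶠ k : TensorIndex d n, A.tensorTerm d k.1 x y := rfl

/-- `a ↦ 1 ⊗ ⋯ ⊗ a ⊗ ⋯ ⊗ 1`, with `a` in the `i`-th place. -/
def insertAt (i : Fin d) : V →ₗ[ℂ] ⨂[ℂ] _ : Fin d, V :=
  (PiTensorProduct.tprod ℂ).toLinearMap (fun _ => A.vac) i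

/-- The vertex operator algebra `T^d(V) = V ⊗ ⋯ ⊗ V`, with vacuum vector `1 ⊗ ⋯ ⊗ 1` and Virasoro
vector `ω ⊗ 1 ⊗ ⋯ ⊗ 1 + ⋯ + 1 ⊗ ⋯ ⊗ 1 ⊗ ω`. -/
def tensorPower : VertexData (⨂[ℂ] _ : Fin d, V) where
  nprod := A.tensorNprod d
  vac := PiTensorProduct.tprod ℂ fun _ => A.vac
  conf := ∑ i, A.insertAt d i A.conf
  truncation x y := by
    obtain ⟨N, hN⟩ := A.exists_tensorTerm_eq_zero d x y
    refine ⟨d * (N : ℤ), fun n hn => ?_⟩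
    rw [tensorNprod_apply]
    refine (finsum_congr fun k => ?_).trans finsum_zero
    refine hN k.1 ?_
    by_contra! h
    have h1 : ∑ i, (k.1 i + 1) ≤ (Finset.univ : Finset (Fin d)).card • (N : ℤ) :=
      Finset.sum_le_card_nsmul _ _ _ fun j _ => h j
    rw [k.2, nsmul_eq_mul, Finset.card_univ, Fintype.card_fin] at h1
    linarith

end Tensor

section Orbifold

variable {V : Type*} [AddCommGroup V] [Module ℂ V] (A : VertexData V) (d : ℕ)

/-- The action of a permutation on the tensor power:
`σ (a¹ ⊗ ⋯ ⊗ aᵈ) = a^{σ⁻¹(1)} ⊗ ⋯ ⊗ a^{σ⁻¹(d)}`. -/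
def permAct (V : Type*) [AddCommGroup V] [Module ℂ V] (d : ℕ) (σ : Equiv.Perm (Fin d)) :
    (⨂[ℂ] _ : Fin d, V) →ₗ[ℂ] (⨂[ℂ] _ : Fin d, V) :=
  (PiTensorProduct.reindex ℂ (fun _ : Fin d => V) σ).toLinearMap

theorem permAct_tprod (σ : Equiv.Perm (Fin d)) (a : Fin d → V) :
    permAct V d σ (PiTensorProduct.tprod ℂ a) =
      PiTensorProduct.tprod ℂ fun i => a (σ⁻¹ i) :=
  PiTensorProduct.reindex_tprod _ _

/-- The subspace of the tensor power fixed by a subgroup `Ω` of `S_d`. -/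
def fixedSubmodule (V : Type*) [AddCommGroup V] [Module ℂ V] (d : ℕ)
    (Ω : Subgroup (Equiv.Perm (Fin d))) : Submodule ℂ (⨂[ℂ] _ : Fin d, V) where
  carrier := {x | ∀ σ ∈ Ω, permAct V d σ x = x}
  add_mem' hx hy σ hσ := by rw [map_add, hx σ hσ, hy σ hσ]
  zero_mem' σ _ := map_zero _
  smul_mem' c x hx σ hσ := by rw [map_smul, hx σ hσ]

theorem permAct_tensorTerm (σ : Equiv.Perm (Fin d)) (k : Fin d → ℤ) (x y : ⨂[ℂ] _ : Fin d, V) :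
    permAct V d σ (A.tensorTerm d k x y) =
      A.tensorTerm d (fun i => k (σ⁻¹ i)) (permAct V d σ x) (permAct V d σ y) := by
  induction x using PiTensorProduct.induction_on with
  | smul_tprod r a =>
    induction y using PiTensorProduct.induction_on with
    | smul_tprod s b =>
      simp only [map_smul, LinearMap.smul_apply, tensorTerm_tprod, permAct_tprod]
    | add y₁ y₂ h₁ h₂ => simp only [map_add, h₁, h₂]
  | add x₁ x₂ h₁ h₂ => simp only [map_add, LinearMap.add_apply, h₁, h₂]

theorem permAct_nprod (σ : Equiv.Perm (Fin d)) (n : ℤ) (x y : ⨂[ℂ] _ : Fin d, V) :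
    permAct V d σ ((A.tensorPower d).nprod n x y) =
      (A.tensorPower d).nprod n (permAct V d σ x) (permAct V d σ y) := by
  change permAct V d σ (A.tensorNprod d n x y) = A.tensorNprod d n _ _
  rw [tensorNprod_apply, tensorNprod_apply]
  have h := (permAct V d σ).toAddMonoidHom.map_finsum (A.finite_support_tensorTerm d n x y)
  simp only [LinearMap.toAddMonoidHom_coe] at h
  rw [h]
  let e : TensorIndex d n ≃ TensorIndex d n :=
    (Equiv.arrowCongr σ (Equiv.refl ℤ)).subtypeEquiv fun k => by
      have : ∑ i, (k (σ.symm i) + 1) = ∑ i, (k i + 1) :=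
        Equiv.sum_comp σ.symm fun i => k i + 1
      simp [Equiv.arrowCongr_apply, Function.comp_def, this]
  rw [← finsum_comp_equiv (f := fun k : TensorIndex d n =>
    A.tensorTerm d k.1 (permAct V d σ x) (permAct V d σ y)) e]
  exact finsum_congr fun k => A.permAct_tensorTerm d σ k.1 x y

theorem permAct_insertAt (σ : Equiv.Perm (Fin d)) (i : Fin d) (a : V) :
    permAct V d σ (A.insertAt d i a) = A.insertAt d (σ i) a := by
  change permAct V d σ (PiTensorProduct.tprod ℂ (Function.update (fun _ => A.vac) i a)) =
    PiTensorProduct.tprod ℂ (Function.update (fun _ => A.vac) (σ i) a)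
  rw [permAct_tprod]
  congr 1
  funext j
  simp only [Function.update_apply, Equiv.Perm.inv_eq_iff_eq]

theorem permAct_sum_insertAt (σ : Equiv.Perm (Fin d)) (a : V) :
    permAct V d σ (∑ i, A.insertAt d i a) = ∑ i, A.insertAt d i a := by
  simp only [map_sum, permAct_insertAt]
  exact Equiv.sum_comp σ fun i => A.insertAt d i a

/-- The permutation orbifold model `T^d(V)^Ω`: the fixed points of `Ω` in `T^d(V)`, with the
restricted products and the same vacuum and Virasoro vectors. -/
def permOrbifold (Ω : Subgroup (Equiv.Perm (Fin d))) : VertexData (fixedSubmodule V d Ω) where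
  nprod n := LinearMap.mk₂ ℂ
    (fun x y => ⟨(A.tensorPower d).nprod n x.1 y.1, fun σ hσ => by
      rw [permAct_nprod, x.2 σ hσ, y.2 σ hσ]⟩)
    (fun _ _ _ => Subtype.ext (by simp))
    (fun _ _ _ => Subtype.ext (by simp))
    (fun _ _ _ => Subtype.ext (by simp))
    (fun _ _ _ => Subtype.ext (by simp))
  vac := ⟨(A.tensorPower d).vac, fun σ _ => permAct_tprod d σ fun _ => A.vac⟩
  conf := ⟨(A.tensorPower d).conf, fun σ _ => A.permAct_sum_insertAt d σ A.conf⟩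
  truncation x y := by
    obtain ⟨N, hN⟩ := (A.tensorPower d).truncation x.1 y.1
    exact ⟨N, fun n hn => Subtype.ext (hN n hn)⟩

/-- `η(a) = a ⊗ 1 ⊗ ⋯ ⊗ 1 + ⋯ + 1 ⊗ ⋯ ⊗ 1 ⊗ a`, as a linear map from `V` to `T^d(V)^{S_d}`. -/
def eta : V →ₗ[ℂ] fixedSubmodule V d ⊤ :=
  LinearMap.codRestrict (fixedSubmodule V d ⊤) (∑ i, A.insertAt d i) fun a σ _ => by
    simpa using A.permAct_sum_insertAt d σ a

end Orbifold

end VertexData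

end

open scoped TensorProduct

noncomputable section

namespace VertexData

variable {V : Type*} [AddCommGroup V] [Module ℂ V] (A : VertexData V)

/-! Over `ℂ` averaging is possible, so the fixed points are spanned by symmetrized pure tensors, and
it suffices to generate these. The `(-1)`-products alone are enough. Since `η(c)` is fixed by `S_d`,
its products commute with symmetrization (`nprod_eta_symmetrize`), and `η(c)_(-1)` sends `Sym(b)` to
the sum over `i` of `Sym(b)` with `b i` replaced by `c_(-1) (b i)` (`tensorNprod_insertAt_tprod`).
If `b` is the vacuum off `s`, the places outside `s` all give the same tensor with one more factor
`c`, while the places in `s` give tensors still supported on `s`. Solving for the former gives an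
induction on the support, in the manner of Newton's identities. -/

theorem nprod_neg_mem_strongSpan {S : Set V} {a v : V} (ha : a ∈ S) {n : ℕ} (hn : 1 ≤ n)
    (hv : v ∈ A.strongSpan S) : A.nprod (-(n : ℤ)) a v ∈ A.strongSpan S := by
  refine (Submodule.span_le (p := (A.strongSpan S).comap (A.nprod (-(n : ℤ)) a))).2 ?_ hv
  rintro _ ⟨w, -, hw, rfl⟩
  refine Submodule.subset_span ⟨(a, n) :: w, by simp, ?_, rfl⟩
  simpa [ha, hn] using hw

/-- Since `1_(k)` is the identity for `k = -1` and zero otherwise, only one index of the sum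
survives. -/
theorem tensorNprod_insertAt_tprod (hA : A.IsVOA) {d : ℕ} (i : Fin d) (c : V) (b : Fin d → V) :
    A.tensorNprod d (-1) (A.insertAt d i c) (PiTensorProduct.tprod ℂ b) =
      PiTensorProduct.tprod ℂ (Function.update b i (A.nprod (-1) c (b i))) := by
  have hterm : ∀ k : TensorIndex d (-1), A.tensorTerm d k.1 (A.insertAt d i c)
      (PiTensorProduct.tprod ℂ b) = PiTensorProduct.tprod ℂ fun l =>
        A.nprod (k.1 l) (Function.update (fun _ => A.vac) i c l) (b l) := fun k =>
    A.tensorTerm_tprod d k.1 _ b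
  rw [tensorNprod_apply, finsum_eq_single _ (⟨fun _ => -1, by simp⟩ : TensorIndex d (-1)), hterm]
  · congr 1
    funext l
    by_cases hl : l = i
    · subst hl; simp
    · simp [hl, hA.vac_nprod]
  · intro k hk
    rw [hterm]
    -- If every other entry were `-1`, the constraint `∑ (k l + 1) = 0` would force `k i = -1` too.
    obtain ⟨l, hli, hl⟩ : ∃ l, l ≠ i ∧ k.1 l ≠ -1 := by
      by_contra! h
      refine hk (Subtype.ext (funext fun l => ?_))
      by_cases hl : l = i
      · have h1 := k.2
        rw [Finset.sum_eq_single i (fun j _ hj => by rw [h j hj]; rfl) (by simp)] at h1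
        subst hl
        exact add_right_cancel h1
      · exact h l hl
    refine (PiTensorProduct.tprod ℂ).map_coord_zero l ?_
    simp [hli, hA.vac_nprod, hl]

/-- The symmetrization `x ↦ ∑ σ x` over all permutations `σ`. -/
def symmetrize (V : Type*) [AddCommGroup V] [Module ℂ V] (d : ℕ) :
    (⨂[ℂ] _ : Fin d, V) →ₗ[ℂ] fixedSubmodule V d ⊤ :=
  LinearMap.codRestrict _ (∑ σ, permAct V d σ) fun x τ _ => by
    induction x using PiTensorProduct.induction_on with
    | smul_tprod r a =>
      simp only [LinearMap.sum_apply, map_sum, map_smul, permAct_tprod]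
      congr 1
      exact Fintype.sum_equiv (Equiv.mulLeft τ) _ _ fun σ => by simp
    | add x y hx hy => rw [map_add, map_add, hx, hy]

theorem coe_symmetrize {d : ℕ} (x : ⨂[ℂ] _ : Fin d, V) :
    (symmetrize V d x : ⨂[ℂ] _ : Fin d, V) = ∑ σ, permAct V d σ x :=
  LinearMap.sum_apply _ _ _

theorem symmetrize_tprod_comp {d : ℕ} (a : Fin d → V) (τ : Equiv.Perm (Fin d)) :
    symmetrize V d (PiTensorProduct.tprod ℂ (a ∘ τ)) =
      symmetrize V d (PiTensorProduct.tprod ℂ a) := by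
  ext1
  simp only [coe_symmetrize, permAct_tprod]
  exact Fintype.sum_equiv (Equiv.mulRight τ⁻¹) _ _ fun σ => by simp

theorem symmetrize_coe {d : ℕ} (x : fixedSubmodule V d ⊤) :
    symmetrize V d x = (d.factorial : ℂ) • x := by
  ext1
  rw [coe_symmetrize, Finset.sum_congr rfl fun σ _ => x.2 σ trivial]
  simp [Fintype.card_perm, Nat.cast_smul_eq_nsmul]

theorem nprod_eta_symmetrize {d : ℕ} (n : ℤ) (c : V) (x : ⨂[ℂ] _ : Fin d, V) :
    (A.permOrbifold d ⊤).nprod n (A.eta d c) (symmetrize V d x) =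
      symmetrize V d (∑ i, A.tensorNprod d n (A.insertAt d i c) x) := by
  ext1
  change A.tensorNprod d n (A.eta d c) (symmetrize V d x) = _
  have h : (A.eta d c : ⨂[ℂ] _ : Fin d, V) = ∑ i, A.insertAt d i c :=
    LinearMap.sum_apply _ _ _
  rw [coe_symmetrize, coe_symmetrize, map_sum, h]
  refine Finset.sum_congr rfl fun σ _ => ?_
  have h1 := A.permAct_nprod d σ n (∑ i, A.insertAt d i c) x
  rw [permAct_sum_insertAt] at h1
  refine h1.symm.trans (congrArg _ ?_)
  change A.tensorNprod d n _ x = _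
  rw [map_sum, LinearMap.sum_apply]

/-- Induction on the set of places holding vectors other than the vacuum. -/
theorem symmetrize_tprod_mem_strongSpan (hA : A.IsVOA) {d : ℕ} (hd : 0 < d) (s : Finset (Fin d))
    (a : Fin d → V) (ha : ∀ i ∉ s, a i = A.vac) :
    symmetrize V d (PiTensorProduct.tprod ℂ a) ∈
      (A.permOrbifold d ⊤).strongSpan (Set.range (A.eta d)) := by
  induction s using Finset.induction_on generalizing a with
  | empty =>
    obtain rfl : a = fun _ => A.vac := funext fun i => ha i (by simp)
    -- The empty word is not allowed, so the vacuum is reached through `η(1)_(-1)`, which multiplies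
    -- it by `d ≠ 0`.
    have h := A.nprod_eta_symmetrize (d := d) (-1) A.vac (PiTensorProduct.tprod ℂ fun _ => A.vac)
    have hsymm : symmetrize V d (PiTensorProduct.tprod ℂ fun _ => A.vac) =
        (d.factorial : ℂ) • (A.permOrbifold d ⊤).vac :=
      symmetrize_coe (A.permOrbifold d ⊤).vac
    simp only [A.tensorNprod_insertAt_tprod hA, hA.nprod_vac, Function.update_eq_self_iff.2,
      Finset.sum_const, Finset.card_univ, Fintype.card_fin, map_nsmul] at h
    rw [← Nat.cast_smul_eq_nsmul ℂ] at h
    rw [← Submodule.smul_mem_iff _ (Nat.cast_ne_zero.2 hd.ne' : (d : ℂ) ≠ 0), ← h, hsymm, map_smul]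
    refine Submodule.smul_mem _ _ (Submodule.subset_span ⟨[(A.eta d A.vac, 1)], by simp, ?_, rfl⟩)
    simp
  | insert j s hj ih =>
    set b := Function.update a j A.vac with hb
    have hbs : ∀ i ∉ s, b i = A.vac := by
      intro i hi
      by_cases hij : i = j
      · simp [hb, hij]
      · simp [hb, hij, ha i (by simp [hij, hi])]
    have h := A.nprod_eta_symmetrize (d := d) (-1) (a j) (PiTensorProduct.tprod ℂ b)
    simp only [A.tensorNprod_insertAt_tprod hA, map_sum] at h
    rw [← Finset.sum_add_sum_compl s] at h
    -- Off `s` the vacuum at place `i` becomes `a j`; the result is `a` with the places `i` and `j`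
    -- exchanged.
    have hcompl : ∀ i ∈ sᶜ, symmetrize V d (PiTensorProduct.tprod ℂ
        (Function.update b i (A.nprod (-1) (a j) (b i)))) =
          symmetrize V d (PiTensorProduct.tprod ℂ a) := by
      intro i hi
      have hi : i ∉ s := by simpa using hi
      rw [hbs i hi, hA.nprod_vac, ← symmetrize_tprod_comp a (Equiv.swap i j)]
      congr 2
      funext l
      simp only [Function.comp_apply, Equiv.swap_apply_def, Function.update_apply]
      split_ifs with h1 h2
      · rfl
      · rw [h2, hbs j hj, ha i]
        simp only [Finset.mem_insert, not_or]
        exact ⟨fun h => h1 (h2.trans h.symm), hi⟩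
      · simp [hb, h2]
    rw [Finset.sum_congr rfl hcompl, Finset.sum_const, ← Nat.cast_smul_eq_nsmul ℂ] at h
    -- The coefficient of `Sym(a)` is `d - |s|`, nonzero because `j ∉ s`.
    have hcard : ((sᶜ.card : ℕ) : ℂ) ≠ 0 :=
      Nat.cast_ne_zero.2 (Finset.card_ne_zero_of_mem (Finset.mem_compl.2 hj))
    rw [← Submodule.smul_mem_iff _ hcard, eq_sub_of_add_eq' h.symm]
    refine Submodule.sub_mem _ ?_ (Submodule.sum_mem _ fun i hi => ih _ fun l hl => ?_)
    · exact (A.permOrbifold d ⊤).nprod_neg_mem_strongSpan (n := 1) (Set.mem_range_self (a j))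
        le_rfl (ih b hbs)
    · rw [Function.update_of_ne (ne_of_mem_of_not_mem hi hl).symm, hbs l hl]

end VertexData

end

theorem mainTheorem9 {V : Type*} [AddCommGroup V] [Module ℂ V] (A : VertexData V)
    (hA : A.IsVOA) (hCFT : A.IsCFTType) (d : ℕ) (hd : 0 < d) :
    (A.permOrbifold d ⊤).IsStronglyGeneratedBy (Set.range (A.eta d)) := by
  refine (Submodule.eq_top_iff').2 fun x => ?_
  have hmem : ∀ y, VertexData.symmetrize V d y ∈
      (A.permOrbifold d ⊤).strongSpan (Set.range (A.eta d)) := by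
    intro y
    induction y using PiTensorProduct.induction_on with
    | smul_tprod r a =>
      rw [map_smul]
      exact Submodule.smul_mem _ _
        (A.symmetrize_tprod_mem_strongSpan hA hd Finset.univ a (by simp))
    | add y z hy hz => rw [map_add]; exact Submodule.add_mem _ hy hz
  have hfac : (d.factorial : ℂ) ≠ 0 := Nat.cast_ne_zero.2 d.factorial_ne_zero
  -- A fixed vector is `1 / d!` times its own symmetrization.
  rw [← Submodule.smul_mem_iff _ hfac, ← VertexData.symmetrize_coe]
  exact hmem x
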